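/- Let $0\le\tau<1$, $b>0$, let $N$ and $k$ be even integers with $0\le k\le N$, and put $m=(N-k)/2$, $\mathbb R^2_+=\{(x,y)\in\mathbb R^2:y>0\}$, $$C_N=\frac{(\sqrt b)^{N(N+1)/2}(\sqrt{1+\tau})^{N(N-1)/2}}{2^{N(N+1)/4}\prod_{l=1}^N\Gamma(l/2)},\qquad \operatorname{erfc}(t)=\frac{2}{\sqrt\pi}\int_t^\infty e^{-s^2}\,ds .$$ The density of the eigenvalues of the partly symmetric real Ginibre ensemble of $N\times N$ matrices on the event of having $k$ real eigenvalues $\lambda_1,\dots,\lambda_k$ and $m$ complex conjugate pairs $x_j\pm iy_j$, $y_j>0$, is $$P_{k,m}=C_N\,\frac{2^{m}}{k!\,m!}\,\Big|\Delta\big(\{\lambda_l\}_{l=1}^k\cup\{x_j\pm iy_j\}_{j=1}^m\big)\Big|\;\prod_{j=1}^k e^{-b\lambda_j^2/2}\;\prod_{j=1}^m e^{b(y_j^2-x_j^2)}\operatorname{erfc}\Big(\sqrt{\tfrac{2b}{1-\tau}}\,y_j\Big),$$ where $\Delta(z_1,\dots,z_N)=\prod_{j<l}(z_l-z_j)$.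 For functions $u:\mathbb R\to\mathbb C$ and $v:\mathbb R^2_+\to\mathbb C$ the generalized partition function is $$Z_{k,m}[u,v]=\int_{\mathbb R^k}\int_{(\mathbb R^2_+)^m}\prod_{l=1}^k u(\lambda_l)\prod_{l=1}^m v(x_l,y_l)\;P_{k,m}\;\prod_{l=1}^m dx_l\,dy_l\;\prod_{l=1}^k d\lambda_l .$$ Let $p_0,\dots,p_{N-1}$ be monic polynomials with $\deg p_j=j$, and for $1\le j,l\le N$ let $$\alpha_{j,l}[u]=\int_{-\infty}^\infty dx\,u(x)\int_{-\infty}^\infty dy\,u(y)\,e^{-b(x^2+y^2)/2}\,p_{j-1}(x)\,p_{l-1}(y)\,\operatorname{sgn}(y-x),$$ $$\beta_{j,l}[v]=2i\int_{\mathbb R^2_+}dx\,dy\,v(x,y)\,e^{b(y^2-x^2)}\operatorname{erfc}\Big(\sqrt{\tfrac{2b}{1-\tau}}\,y\Big)\Big(p_{j-1}(x+iy)\,p_{l-1}(x-iy)-p_{l-1}(x+iy)\,p_{j-1}(x-iy)\Big).$$ Assume that $u$ and $v$ are such that these integrals converge absolutely for all $1\le j,l\le N$. Then the integral defining $Z_{k,m}[u,v]$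 converges absolutely, and $$Z_{k,(N-k)/2}[u,v]=C_N\,[\zeta^{k/2}]\operatorname{Pf}\big[\zeta\,\alpha_{j,l}[u]+\beta_{j,l}[v]\big]_{j,l=1,\dots,N},$$ where $[\zeta^{q}]f(\zeta)$ denotes the coefficient of $\zeta^{q}$ in the polynomial $f(\zeta)$ and $\operatorname{Pf}$ is the Pfaffian. -/

import Mathlib

namespace PartlySymmetricGinibre

open Polynomial

noncomputable section

/-- The complementary error function `erfc x = (2 / √π) ∫_x^∞ e^{-t²} dt`. -/
def erfc (x : ℝ) : ℝ :=
  2 / √Real.pi * ∫ t in Set.Ioi x, Real.exp (-t ^ 2)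

/-- The Pfaffian of an antisymmetric matrix of even size `N`,
`Pf A = 1 / (2^{N/2} (N/2)!) ∑_σ sgn σ ∏_{i < N/2} A_{σ(2i), σ(2i+1)}` (indices from `0`). -/
def pfaffian {R : Type*} [CommRing R] [Algebra ℚ R] {N : ℕ} (A : Matrix (Fin N) (Fin N) R) : R :=
  (((2 : ℚ) ^ (N / 2) * ((N / 2).factorial : ℚ))⁻¹ : ℚ) •
    ∑ σ : Equiv.Perm (Fin N), (Equiv.Perm.sign σ : ℤ) •
      ∏ i : Fin (N / 2),
        A (σ ⟨2 * (i : ℕ), by have := i.isLt; omega⟩) (σ ⟨2 * (i : ℕ) + 1, by have := i.isLt; omega⟩)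

/-- The product of differences `Δ(z) = ∏_{j < l} (z_l - z_j)`. -/
def Delta {N : ℕ} (z : Fin N → ℂ) : ℂ :=
  ∏ j : Fin N, ∏ l ∈ Finset.Ioi j, (z l - z j)

/-- The family `λ_1, …, λ_k, x_1 + i y_1, x_1 - i y_1, …, x_m + i y_m, x_m - i y_m`. -/
def eigenvalues {k m : ℕ} (lam : Fin k → ℝ) (w : Fin m → ℝ × ℝ) : Fin (k + 2 * m) → ℂ :=
  Fin.append (fun j => (lam j : ℂ)) (fun i : Fin (2 * m) =>
    if (i : ℕ) % 2 = 0 then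
      ((w ⟨(i : ℕ) / 2, by have := i.isLt; omega⟩).1 : ℂ)
        + Complex.I * ((w ⟨(i : ℕ) / 2, by have := i.isLt; omega⟩).2 : ℂ)
    else
      ((w ⟨(i : ℕ) / 2, by have := i.isLt; omega⟩).1 : ℂ)
        - Complex.I * ((w ⟨(i : ℕ) / 2, by have := i.isLt; omega⟩).2 : ℂ))

/-- The open upper half plane `ℝ₊² = {(x, y) : y > 0}`. -/
def upperHalf : Set (ℝ × ℝ) := {q | 0 < q.2}

/-- The weight `e^{-b x² / 2}` of a real eigenvalue. -/
def realWeight (b x : ℝ) : ℝ := Real.exp (-b * x ^ 2 / 2)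

/-- The weight `e^{b (y² - x²)} erfc(√(2b / (1 - τ)) y)` of a complex conjugate pair `x ± i y`. -/
def complexWeight (τ b : ℝ) (q : ℝ × ℝ) : ℝ :=
  Real.exp (b * (q.2 ^ 2 - q.1 ^ 2)) * erfc (√(2 * b / (1 - τ)) * q.2)

/-- The constant
`(√b)^{N(N+1)/2} (√(1+τ))^{N(N-1)/2} / (2^{N(N+1)/4} ∏_{l=1}^N Γ(l/2))`. -/
def normalization (N : ℕ) (τ b : ℝ) : ℝ :=
  (√b ^ (N * (N + 1) / 2) * √(1 + τ) ^ (N * (N - 1) / 2)) /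
    ((2 : ℝ) ^ (((N : ℝ) * ((N : ℝ) + 1)) / 4) * ∏ l ∈ Finset.Icc 1 N, Real.Gamma ((l : ℝ) / 2))

/-- The eigenvalue density `P_{k,m}(λ_1, …, λ_k; x_1 ± i y_1, …, x_m ± i y_m; τ, b)` of the partly
symmetric real Ginibre ensemble of `N × N` matrices, `N = k + 2m`, for `k` real eigenvalues and `m`
complex conjugate pairs. -/
def eigenvalueDensity (k m : ℕ) (τ b : ℝ) (lam : Fin k → ℝ) (w : Fin m → ℝ × ℝ) : ℝ :=
  normalization (k + 2 * m) τ b * (2 ^ m / ((k.factorial : ℝ) * (m.factorial : ℝ))) *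
    ‖Delta (eigenvalues lam w)‖ *
    (∏ j, realWeight b (lam j)) * ∏ j, complexWeight τ b (w j)

/-- The integrand of the generalized partition function. -/
def partitionIntegrand (k m : ℕ) (τ b : ℝ) (u : ℝ → ℂ) (v : ℝ × ℝ → ℂ)
    (s : (Fin k → ℝ) × (Fin m → ℝ × ℝ)) : ℂ :=
  (∏ l, u (s.1 l)) * (∏ l, v (s.2 l)) * (eigenvalueDensity k m τ b s.1 s.2 : ℂ)

/-- The domain of integration `λ_j ∈ ℝ`, `(x_j, y_j) ∈ ℝ₊²`. -/
def partitionDomain (k m : ℕ) : Set ((Fin k → ℝ) × (Fin m → ℝ × ℝ)) :=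
  {s | ∀ j, s.2 j ∈ upperHalf}

/-- The generalized partition function `Z_{k,m}[u, v]`. -/
def partitionFunction (k m : ℕ) (τ b : ℝ) (u : ℝ → ℂ) (v : ℝ × ℝ → ℂ) : ℂ :=
  ∫ s in partitionDomain k m, partitionIntegrand k m τ b u v s

/-- `α[u]` for a pair of polynomials `f = p_{j-1}`, `g = p_{l-1}`. -/
def alpha (b : ℝ) (u : ℝ → ℂ) (f g : ℂ[X]) : ℂ :=
  ∫ x : ℝ, u x * ∫ y : ℝ, u y * (Real.exp (-b * (x ^ 2 + y ^ 2) / 2) : ℂ) *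
    f.eval (x : ℂ) * g.eval (y : ℂ) * (Real.sign (y - x) : ℂ)

/-- The integrand of `β[v]`, without the prefactor `2i`. -/
def betaIntegrand (τ b : ℝ) (v : ℝ × ℝ → ℂ) (f g : ℂ[X]) (q : ℝ × ℝ) : ℂ :=
  v q * (complexWeight τ b q : ℂ) *
    (f.eval ((q.1 : ℂ) + Complex.I * q.2) * g.eval ((q.1 : ℂ) - Complex.I * q.2)
      - g.eval ((q.1 : ℂ) + Complex.I * q.2) * f.eval ((q.1 : ℂ) - Complex.I * q.2))

/-- `β[v]` for a pair of polynomials `f = p_{j-1}`, `g = p_{l-1}`. -/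
def beta (τ b : ℝ) (v : ℝ × ℝ → ℂ) (f g : ℂ[X]) : ℂ :=
  2 * Complex.I * ∫ q in upperHalf, betaIntegrand τ b v f g q

/-- The matrix `[ζ α_{j,l}[u] + β_{j,l}[v]]` with entries in `ℂ[ζ]`. -/
def skewMatrix {N : ℕ} (τ b : ℝ) (u : ℝ → ℂ) (v : ℝ × ℝ → ℂ) (p : Fin N → ℂ[X]) :
    Matrix (Fin N) (Fin N) ℂ[X] :=
  Matrix.of fun j l => X * C (alpha b u (p j) (p l)) + C (beta τ b v (p j) (p l))

end

end PartlySymmetricGinibre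

/-! This is de Bruijn's method of integrating a determinant into a Pfaffian. Put k = 2h. Two
obstacles keep the density from being a sum of products: the modulus of the Vandermonde product, and
the coupling of the real eigenvalues through its sign.

A conjugate pair added to a conjugation-invariant family multiplies Δ by a nonnegative square times
-2iy. Hence |Δ| = i^m · s(λ) · Δ on the upper half plane, where s(λ) is the sign of the real
Vandermonde determinant (`norm_Delta_eigenvalues`). Schur's identity writes s(λ) as the Pfaffian of
the matrix sgn(λ_l - λ_j), a signed sum over pairings of the real variables
(`sum_sign_mul_prod_sign`).

Δ itself is the determinant of p_j(z_l), an alternating sum over assignments of polynomials to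
eigenvalues. Antisymmetrizing in each complex pair produces the β integrand, and each Schur pairing
produces α integrands. Every term is now a product over disjoint pairs of variables, so Fubini turns
the integral into an alternating sum of products of h entries of α and m entries of β. Up to the
combinatorial constant this is the ζ^h coefficient of the Pfaffian (`coeff_pfaffian_eq_altSum`). -/

namespace PartlySymmetricGinibre

open Polynomial Equiv MeasureTheory

noncomputable section

/-! ### Schur's Pfaffian identity for the sign matrix -/

/-- The sum over all permutations of `Fin (n + 1)`, sorted by the image of `0`. -/
theorem sum_perm_fin_succ {M : Type*} [AddCommMonoid M] {n : ℕ} (g : Perm (Fin (n + 1)) → M) :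
    ∑ σ, g σ = ∑ p : Fin (n + 1), ∑ e : Perm (Fin n),
      g (p.cycleRange.symm * Perm.decomposeFin.symm (0, e)) := by
  rw [← Fintype.sum_prod_type' (f := fun (p : Fin (n + 1)) (e : Perm (Fin n)) =>
    g (p.cycleRange.symm * Perm.decomposeFin.symm (0, e)))]
  symm
  refine Function.Bijective.sum_comp
    (e := fun q : Fin (n + 1) × Perm (Fin n) =>
      q.1.cycleRange.symm * Perm.decomposeFin.symm (0, q.2)) ?_ g
  rw [Fintype.bijective_iff_injective_and_card]
  constructor
  · rintro ⟨p, e⟩ ⟨q, f⟩ h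
    have h0 : p = q := by
      have := congrArg (fun σ : Perm (Fin (n + 1)) => σ 0) h
      simpa using this
    subst h0
    have := mul_left_cancel h
    simpa using this
  · simp [Fintype.card_perm, Nat.factorial_succ]

/-- Raising p by one flips only the term of index p, which changes the sum by -2(-1)^p. At p = 0 the
sum is 1 because the number of terms is odd. -/
theorem sum_neg_one_pow_ite (n p : ℕ) (hp : p ≤ 2 * n + 1) :
    ∑ q ∈ Finset.range (2 * n + 1), (-1 : ℝ) ^ q * (if q < p then -1 else 1) = (-1) ^ p := by
  induction p with
  | zero =>
    simp only [not_lt_zero, if_false, mul_one, pow_zero]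
    rw [neg_one_geom_sum]; simp
  | succ p ih =>
    have h1 := ih (by omega)
    have h2 : ∑ q ∈ Finset.range (2 * n + 1), (-1 : ℝ) ^ q * (if q < p + 1 then -1 else 1) =
        ∑ q ∈ Finset.range (2 * n + 1), ((-1 : ℝ) ^ q * (if q < p then -1 else 1)
          + if q = p then -2 * (-1) ^ p else 0) := by
      refine Finset.sum_congr rfl fun q _ => ?_
      rcases lt_trichotomy q p with h | h | h
      · simp [h, h.ne, Nat.lt_succ_of_lt h]
      · subst h; simp; ring
      · have : ¬ q < p + 1 := by omega
        simp [this, h.ne', not_lt.2 h.le]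
    rw [h2, Finset.sum_add_distrib, h1, Finset.sum_ite_eq' , if_pos (by simp; omega)]
    ring

/-- Induction on the number of pairs, with the images of positions 0 and 1 split off. If 0 goes to p
and 1 to the q-th remaining index, these choices carry the sign (-1)^(p+q), and the first factor is
-1 exactly when q < p. By `sum_neg_one_pow_ite` the sum over q cancels (-1)^p, so each of the 2n + 2
values of p contributes 2^n n!. -/
theorem sum_sign_mul_prod_sign_of_strictMono (n : ℕ) (x : Fin (2 * n) → ℝ) (hx : StrictMono x) :
    ∑ π : Perm (Fin (2 * n)), ((Perm.sign π : ℤ) : ℝ) *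
      ∏ i : Fin n, Real.sign (x (π ⟨2 * i + 1, by omega⟩) - x (π ⟨2 * i, by omega⟩))
      = 2 ^ n * n.factorial := by
  induction n with
  | zero => simp
  | succ n ih =>
    change ∑ π : Perm (Fin (2 * n + 1 + 1)), _ = _
    change Fin (2 * n + 1 + 1) → ℝ at x
    rw [sum_perm_fin_succ]
    have key : ∀ p : Fin (2 * n + 1 + 1), ∀ q : Fin (2 * n + 1),
        Real.sign (x (p.succAbove q) - x p) = if (q : ℕ) < p then -1 else 1 := by
      intro p q
      split_ifs with h
      · exact Real.sign_of_neg (sub_neg.2 (hx (by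
          rw [Fin.succAbove_lt_iff_castSucc_lt]; exact h)))
      · exact Real.sign_of_pos (sub_pos.2 (hx (by
          rw [Fin.lt_succAbove_iff_le_castSucc]; exact not_lt.1 h)))
    have step : ∀ p : Fin (2 * n + 1 + 1), ∑ e : Perm (Fin (2 * n + 1)),
        ((Perm.sign (p.cycleRange.symm * Perm.decomposeFin.symm (0, e)) : ℤ) : ℝ) *
        ∏ i : Fin (n + 1),
          Real.sign (x ((p.cycleRange.symm * Perm.decomposeFin.symm (0, e)) ⟨2 * i + 1, by omega⟩)
            - x ((p.cycleRange.symm * Perm.decomposeFin.symm (0, e)) ⟨2 * i, by omega⟩))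
        = 2 ^ n * n.factorial := by
      intro p
      rw [sum_perm_fin_succ]
      have inner : ∀ q : Fin (2 * n + 1), ∀ e : Perm (Fin (2 * n)),
          ((Perm.sign (p.cycleRange.symm * Perm.decomposeFin.symm
            (0, q.cycleRange.symm * Perm.decomposeFin.symm (0, e))) : ℤ) : ℝ) *
          ∏ i : Fin (n + 1),
          Real.sign (x ((p.cycleRange.symm * Perm.decomposeFin.symm
              (0, q.cycleRange.symm * Perm.decomposeFin.symm (0, e))) ⟨2 * i + 1, by omega⟩)
            - x ((p.cycleRange.symm * Perm.decomposeFin.symm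
              (0, q.cycleRange.symm * Perm.decomposeFin.symm (0, e))) ⟨2 * i, by omega⟩)) =
          ((-1) ^ (p : ℕ) * ((-1) ^ (q : ℕ) * (if (q : ℕ) < p then -1 else 1))) *
            (((Perm.sign e : ℤ) : ℝ) * ∏ i : Fin n,
              Real.sign (x (p.succAbove (q.succAbove (e ⟨2 * i + 1, by omega⟩)))
                - x (p.succAbove (q.succAbove (e ⟨2 * i, by omega⟩))))) := by
        intro q e
        rw [Fin.prod_univ_succ]
        have h0 : (⟨2 * ((0 : Fin (n + 1)) : ℕ), by simp⟩ : Fin (2 * n + 1 + 1)) = 0 := by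
          ext; simp
        have h1 : (⟨2 * ((0 : Fin (n + 1)) : ℕ) + 1, by simp⟩ : Fin (2 * n + 1 + 1))
            = Fin.succ 0 := by ext; simp
        have h2 : ∀ i : Fin n, (⟨2 * (i.succ : ℕ), by have := i.2; simp; omega⟩ :
            Fin (2 * n + 1 + 1)) = Fin.succ (Fin.succ ⟨2 * i, by omega⟩) := by
          intro i; ext; simp; ring
        have h3 : ∀ i : Fin n, (⟨2 * (i.succ : ℕ) + 1, by simp⟩ :
            Fin (2 * n + 1 + 1)) = Fin.succ (Fin.succ ⟨2 * i + 1, by omega⟩) := by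
          intro i; ext; simp; ring
        simp only [h0, h1, h2, h3, Perm.mul_apply, Perm.decomposeFin_symm_apply_zero,
          Perm.decomposeFin_symm_apply_succ, swap_self, refl_apply,
          Fin.cycleRange_symm_zero, Fin.cycleRange_symm_succ, key]
        simp only [Perm.sign_mul, Perm.decomposeFin.symm_sign, if_true, Perm.sign_symm,
          Fin.sign_cycleRange]
        push_cast
        ring
      simp only [inner, ← Finset.mul_sum]
      have ih' : ∀ q : Fin (2 * n + 1), _ := fun q => ih
        (fun i => x (p.succAbove (q.succAbove i)))
        (hx.comp ((Fin.strictMono_succAbove p).comp (Fin.strictMono_succAbove q)))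
      simp only [ih', ← Finset.sum_mul, ← Finset.mul_sum]
      rw [Fin.sum_univ_eq_sum_range (fun q => (-1 : ℝ) ^ q * (if q < (p : ℕ) then -1 else 1)),
        sum_neg_one_pow_ite n p (by omega), ← mul_pow]
      simp
    refine (Finset.sum_congr rfl fun p _ => step p).trans ?_
    simp [Nat.factorial_succ]
    ring

/-- The sign `∏_{i < j} sgn (x_j - x_i)` of the Vandermonde determinant. -/
def orderSign {n : ℕ} (x : Fin n → ℝ) : ℝ := Real.sign (Matrix.vandermonde x).det

theorem orderSign_comp_perm {n : ℕ} (x : Fin n → ℝ) (ρ : Perm (Fin n)) :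
    orderSign (x ∘ ρ) = ((Perm.sign ρ : ℤ) : ℝ) * orderSign x := by
  have : (Matrix.vandermonde (x ∘ ρ)) = (Matrix.vandermonde x).submatrix ρ id := by
    ext i j; simp [Matrix.vandermonde_apply]
  rw [orderSign, orderSign, this, Matrix.det_permute]
  rcases Int.units_eq_one_or (Perm.sign ρ) with h | h <;> simp [h, Real.sign_neg]

theorem orderSign_of_strictMono {n : ℕ} {x : Fin n → ℝ} (hx : StrictMono x) :
    orderSign x = 1 := by
  rw [orderSign, Matrix.det_vandermonde]
  refine Real.sign_of_pos (Finset.prod_pos fun i _ => Finset.prod_pos fun j hj => ?_)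
  exact sub_pos.2 (hx (Finset.mem_Ioi.1 hj))

theorem orderSign_of_not_injective {n : ℕ} {x : Fin n → ℝ} (hx : ¬ Function.Injective x) :
    orderSign x = 0 := by
  rw [orderSign, Real.sign_eq_zero_iff]
  by_contra h
  exact hx (Matrix.det_vandermonde_ne_zero_iff.1 h)

/-- Schur's Pfaffian identity for the sign matrix. -/
theorem sum_sign_mul_prod_sign (n : ℕ) (x : Fin (2 * n) → ℝ) :
    ∑ π : Perm (Fin (2 * n)), ((Perm.sign π : ℤ) : ℝ) *
      ∏ i : Fin n, Real.sign (x (π ⟨2 * i + 1, by omega⟩) - x (π ⟨2 * i, by omega⟩))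
      = 2 ^ n * n.factorial * orderSign x := by
  have comp : ∀ ρ : Perm (Fin (2 * n)), ∀ x : Fin (2 * n) → ℝ,
      ∑ π : Perm (Fin (2 * n)), ((Perm.sign π : ℤ) : ℝ) * ∏ i : Fin n,
        Real.sign (x (ρ (π ⟨2 * i + 1, by omega⟩)) - x (ρ (π ⟨2 * i, by omega⟩)))
      = ((Perm.sign ρ : ℤ) : ℝ) * ∑ π : Perm (Fin (2 * n)), ((Perm.sign π : ℤ) : ℝ) *
      ∏ i : Fin n, Real.sign (x (π ⟨2 * i + 1, by omega⟩) - x (π ⟨2 * i, by omega⟩)) := by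
    intro ρ x
    conv_rhs => rw [← Equiv.sum_comp (Equiv.mulLeft ρ), Finset.mul_sum]
    refine Finset.sum_congr rfl fun π _ => ?_
    simp only [Equiv.coe_mulLeft, Perm.sign_mul, Perm.mul_apply, ← mul_assoc]
    rcases Int.units_eq_one_or (Perm.sign ρ) with h | h <;> simp [h]
  -- Without ties, sorting reduces to the increasing case, both sides changing by the sign of the
  -- sorting permutation. With a tie, a transposition fixes x and negates the sum, which therefore
  -- vanishes.
  by_cases hx : Function.Injective x
  · have hs : StrictMono (x ∘ Tuple.sort x) :=
      (Tuple.monotone_sort x).strictMono_of_injective (hx.comp (Tuple.sort x).injective)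
    have h1 := sum_sign_mul_prod_sign_of_strictMono n _ hs
    have h2 := orderSign_comp_perm x (Tuple.sort x)
    rw [orderSign_of_strictMono hs] at h2
    simp only [Function.comp_apply] at h1
    rw [comp] at h1
    rcases Int.units_eq_one_or (Perm.sign (Tuple.sort x)) with h | h <;>
      simp only [h, Units.val_one, Units.val_neg, Int.cast_one, Int.cast_neg, neg_mul,
        one_mul] at h1 h2
    · rw [h1, ← h2, mul_one]
    · have h3 : orderSign x = -1 := by linarith
      rw [h3]; linarith
  · rw [orderSign_of_not_injective hx, mul_zero]
    obtain ⟨i, j, hij, hne⟩ : ∃ i j, x i = x j ∧ i ≠ j := by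
      simpa [Function.Injective] using hx
    have h := comp (swap i j) x
    have hxs : ∀ a, x (swap i j a) = x a := by
      intro a
      rcases eq_or_ne a i with rfl | hi
      · simp [hij]
      · rcases eq_or_ne a j with rfl | hj
        · simp [hij]
        · rw [swap_apply_of_ne_of_ne hi hj]
    simp only [hxs, Perm.sign_swap hne] at h
    push_cast at h
    linarith

/-! ### Alternating sums over positions grouped in pairs -/

/-- The alternating sum `∑_σ sgn σ Φ(σ ∘ E)` over all bijections `σ ∘ E`. -/
def altSum {ι κ R : Type*} [Fintype κ] [DecidableEq κ] [Ring R] (E : ι ≃ κ)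
    (Φ : (ι → κ) → R) : R :=
  ∑ σ : Perm κ, ((Perm.sign σ : ℤ) : R) * Φ (fun a => σ (E a))

section altSum

variable {ι κ R : Type*} [Fintype κ] [DecidableEq κ] [CommRing R]

theorem altSum_comp_perm [Fintype ι] [DecidableEq ι] (E : ι ≃ κ) (Φ : (ι → κ) → R) (ρ : Perm ι) :
    altSum E (fun s => Φ (fun a => s (ρ a))) = ((Perm.sign ρ : ℤ) : R) * altSum E Φ := by
  unfold altSum
  conv_rhs => rw [← Equiv.sum_comp (Equiv.mulRight (E.permCongr ρ)), Finset.mul_sum]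
  refine Finset.sum_congr rfl fun σ _ => ?_
  have : ∀ a, E (ρ a) = E.permCongr ρ (E a) := by simp
  simp only [this, Equiv.coe_mulRight, Perm.sign_mul, Perm.mul_apply, ← mul_assoc,
    Perm.sign_permCongr]
  rcases Int.units_eq_one_or (Perm.sign ρ) with h | h <;> simp [h]

theorem altSum_sum {α : Type*} (s : Finset α) (E : ι ≃ κ) (Φ : α → (ι → κ) → R) :
    altSum E (fun t => ∑ a ∈ s, Φ a t) = ∑ a ∈ s, altSum E (Φ a) := by
  unfold altSum
  simp only [Finset.mul_sum]
  rw [Finset.sum_comm]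

theorem altSum_const_mul (c : R) (E : ι ≃ κ) (Φ : (ι → κ) → R) :
    altSum E (fun t => c * Φ t) = c * altSum E Φ := by
  unfold altSum
  simp only [Finset.mul_sum]
  exact Finset.sum_congr rfl fun _ _ => by ring

end altSum

/-- The positions `2 i + e` with `i < n` and `e < 2`. -/
def pairEquiv (n : ℕ) : Fin n × Fin 2 ≃ Fin (2 * n) :=
  finProdFinEquiv.trans (finCongr (mul_comm n 2))

theorem pairEquiv_zero (n : ℕ) (i : Fin n) : pairEquiv n (i, 0) = ⟨2 * i, by omega⟩ := by
  ext; simp [pairEquiv, finProdFinEquiv]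

theorem pairEquiv_one (n : ℕ) (i : Fin n) : pairEquiv n (i, 1) = ⟨2 * i + 1, by omega⟩ := by
  ext; simp [pairEquiv, finProdFinEquiv]; ring

/-- The pairs of positions, the first `h` pairs followed by the last `m` ones. -/
def splitEquiv (h m : ℕ) : (Fin h ⊕ Fin m) × Fin 2 ≃ Fin (2 * h + 2 * m) :=
  (sumProdDistrib _ _ _).trans ((sumCongr (pairEquiv h) (pairEquiv m)).trans finSumFinEquiv)

theorem splitEquiv_inl (h m : ℕ) (i : Fin h) (e : Fin 2) :
    splitEquiv h m (Sum.inl i, e) = Fin.castAdd (2 * m) (pairEquiv h (i, e)) := by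
  simp [splitEquiv]

theorem splitEquiv_inr (h m : ℕ) (i : Fin m) (e : Fin 2) :
    splitEquiv h m (Sum.inr i, e) = Fin.natAdd (2 * h) (pairEquiv m (i, e)) := by
  simp [splitEquiv]

theorem sum_perm_fin_two {R : Type*} [AddCommMonoid R] (f : Perm (Fin 2) → R) :
    ∑ e, f e = f 1 + f (swap 0 1) := by
  have : (Finset.univ : Finset (Perm (Fin 2))) = {1, swap 0 1} := by decide
  rw [this, Finset.sum_pair (by decide)]

section altSum

variable {ι α β κ R : Type*} [Fintype ι] [DecidableEq ι] [Fintype α] [DecidableEq α] [Fintype β]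
  [DecidableEq β] [Fintype κ] [DecidableEq κ] [CommRing R]

/-- Expanding the differences gives a signed sum over the ways to swap the two positions of some
pairs. A swap can be absorbed into σ, whose sign change cancels the sign of the term, so all 2^|β|
terms agree. -/
theorem altSum_prod_antisymm (E : (α ⊕ β) × Fin 2 ≃ κ) (a : (α × Fin 2 → κ) → R)
    (g : β → κ → κ → R) :
    altSum E (fun s => a (fun q => s (Sum.inl q.1, q.2)) *
      ∏ i, (g i (s (Sum.inr i, 0)) (s (Sum.inr i, 1)) - g i (s (Sum.inr i, 1)) (s (Sum.inr i, 0))))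
    = 2 ^ Fintype.card β * altSum E (fun s => a (fun q => s (Sum.inl q.1, q.2)) *
      ∏ i, g i (s (Sum.inr i, 0)) (s (Sum.inr i, 1))) := by
  have expand : ∀ s : (α ⊕ β) × Fin 2 → κ,
      ∏ i, (g i (s (Sum.inr i, 0)) (s (Sum.inr i, 1))
        - g i (s (Sum.inr i, 1)) (s (Sum.inr i, 0)))
      = ∑ ε : β → Perm (Fin 2), (∏ i, ((Perm.sign (ε i) : ℤ) : R)) *
          ∏ i, g i (s (Sum.inr i, ε i 0)) (s (Sum.inr i, ε i 1)) := by
    intro s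
    simp only [← Finset.prod_mul_distrib]
    rw [← Fintype.prod_sum (fun i (e : Perm (Fin 2)) => ((Perm.sign e : ℤ) : R) *
      g i (s (Sum.inr i, e 0)) (s (Sum.inr i, e 1)))]
    refine Finset.prod_congr rfl fun i _ => ?_
    rw [sum_perm_fin_two]
    simp [sub_eq_add_neg]
  simp only [expand, Finset.mul_sum]
  rw [altSum_sum]
  have each : ∀ ε : β → Perm (Fin 2),
      altSum E (fun s => a (fun q => s (Sum.inl q.1, q.2)) *
        ((∏ i, ((Perm.sign (ε i) : ℤ) : R)) *
          ∏ i, g i (s (Sum.inr i, ε i 0)) (s (Sum.inr i, ε i 1))))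
      = altSum E (fun s => a (fun q => s (Sum.inl q.1, q.2)) *
          ∏ i, g i (s (Sum.inr i, 0)) (s (Sum.inr i, 1))) := by
    intro ε
    have h1 := altSum_comp_perm E (fun s => a (fun q => s (Sum.inl q.1, q.2)) *
      ∏ i, g i (s (Sum.inr i, 0)) (s (Sum.inr i, 1)))
      (prodCongrRight (Sum.elim (fun _ => 1) ε))
    simp only [prodCongrRight_apply, Sum.elim_inl, Sum.elim_inr, Perm.one_apply] at h1
    simp only [mul_left_comm (a _)]
    rw [altSum_const_mul, h1, ← mul_assoc, Perm.sign_prodCongrRight, Fintype.prod_sum_type]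
    simp only [Sum.elim_inl, Sum.elim_inr, Perm.sign_one, Finset.prod_const_one, one_mul]
    rw [← Int.cast_prod, ← Units.coe_prod, ← Int.cast_mul, ← Units.val_mul, Int.units_mul_self]
    simp
  rw [Finset.sum_congr rfl fun ε _ => each ε]
  simp [Fintype.card_perm, nsmul_eq_mul]

/-- Every choice of the pairs that carry the factor `A` gives the same alternating sum. -/
theorem altSum_prod_subset (E : ι × Fin 2 ≃ κ) (A B : κ → κ → R) (s t : Finset ι)
    (hst : s.card = t.card) :
    altSum E (fun σ => (∏ i ∈ s, A (σ (i, 0)) (σ (i, 1))) * ∏ i ∈ sᶜ, B (σ (i, 0)) (σ (i, 1)))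
    = altSum E (fun σ =>
        (∏ i ∈ t, A (σ (i, 0)) (σ (i, 1))) * ∏ i ∈ tᶜ, B (σ (i, 0)) (σ (i, 1))) := by
  obtain ⟨e, he⟩ : ∃ e : Perm ι, s.map e.toEmbedding = t :=
    Perm.exists_map_finset_eq s t hst
  have he' : sᶜ.map e.toEmbedding = tᶜ := by
    rw [← he]; ext x; simp
  -- Permuting whole pairs by e acts as e on both members, so its sign is sgn(e)² = 1.
  have h1 := altSum_comp_perm E (fun σ =>
      (∏ i ∈ s, A (σ (i, 0)) (σ (i, 1))) * ∏ i ∈ sᶜ, B (σ (i, 0)) (σ (i, 1)))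
      (prodCongrLeft fun _ => e)
  rw [Perm.sign_prodCongrLeft] at h1
  simp only [prodCongrLeft_apply, Fin.prod_univ_two, Int.units_mul_self, Units.val_one,
    Int.cast_one, one_mul] at h1
  rw [← h1, ← he', ← he]
  simp [Finset.prod_map]

end altSum

/-! ### The coefficient of the Pfaffian as an alternating sum -/

/-- The coefficient of X^h selects the sets of h pairs that carry A. By `altSum_prod_subset` every
such set contributes as much as the first h pairs, and binom(h+m, h) / (h+m)! = 1 / (h! m!). -/
theorem coeff_pfaffian_eq_altSum (h m : ℕ)
    (A B : Fin (2 * h + 2 * m) → Fin (2 * h + 2 * m) → ℂ) :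
    (pfaffian (Matrix.of fun j l => X * C (A j l) + C (B j l))).coeff h =
      (2 ^ (h + m) * h.factorial * m.factorial : ℂ)⁻¹ *
        altSum (splitEquiv h m) (fun s =>
          (∏ i, A (s (Sum.inl i, 0)) (s (Sum.inl i, 1))) *
            ∏ i, B (s (Sum.inr i, 0)) (s (Sum.inr i, 1))) := by
  have hN : (2 * h + 2 * m) / 2 = h + m := by omega
  have hprod : ∀ σ : Perm (Fin (2 * h + 2 * m)), ∏ i : Fin ((2 * h + 2 * m) / 2),
      (Matrix.of fun j l => X * C (A j l) + C (B j l) : Matrix _ _ ℂ[X])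
        (σ ⟨2 * (i : ℕ), by have := i.isLt; omega⟩)
        (σ ⟨2 * (i : ℕ) + 1, by have := i.isLt; omega⟩) =
      ∏ j : Fin h ⊕ Fin m, (X * C (A (σ (splitEquiv h m (j, 0))) (σ (splitEquiv h m (j, 1))))
        + C (B (σ (splitEquiv h m (j, 0))) (σ (splitEquiv h m (j, 1))))) := by
    intro σ
    symm
    refine Fintype.prod_equiv (finSumFinEquiv.trans (finCongr hN.symm)) _ _ fun j => ?_
    have e0 : splitEquiv h m (j, 0) =
        ⟨2 * ((finSumFinEquiv.trans (finCongr hN.symm)) j : ℕ), by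
          have := ((finSumFinEquiv.trans (finCongr hN.symm)) j).isLt; omega⟩ := by
      rcases j with j | j
      · rw [splitEquiv_inl, pairEquiv_zero]; ext; simp
      · rw [splitEquiv_inr, pairEquiv_zero]; ext; simp; ring
    have e1 : splitEquiv h m (j, 1) =
        ⟨2 * ((finSumFinEquiv.trans (finCongr hN.symm)) j : ℕ) + 1, by
          have := ((finSumFinEquiv.trans (finCongr hN.symm)) j).isLt; omega⟩ := by
      rcases j with j | j
      · rw [splitEquiv_inl, pairEquiv_one]; ext; simp
      · rw [splitEquiv_inr, pairEquiv_one]; ext; simp; ring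
    rw [e0, e1, Matrix.of_apply]
  have hcoeff : ∀ a b : Fin h ⊕ Fin m → ℂ, (∏ j, (X * C (a j) + C (b j))).coeff h =
      ∑ t ∈ Finset.univ.powersetCard h, (∏ j ∈ t, a j) * ∏ j ∈ tᶜ, b j := by
    intro a b
    rw [Finset.prod_add, finsetSum_coeff, ← Finset.sum_filter_add_sum_filter_not
      (s := Finset.univ.powerset) (p := fun t : Finset (Fin h ⊕ Fin m) => t.card = h),
      ← Finset.powersetCard_eq_filter]
    have : ∀ t : Finset (Fin h ⊕ Fin m),
        ((∏ i ∈ t, X * C (a i)) * ∏ i ∈ Finset.univ \ t, C (b i)).coeff h =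
        if t.card = h then (∏ j ∈ t, a j) * ∏ j ∈ tᶜ, b j else 0 := by
      intro t
      rw [Finset.prod_mul_distrib, Finset.prod_const, mul_assoc, ← map_prod, ← map_prod, ← C_mul,
        coeff_mul_C, coeff_X_pow, Finset.compl_eq_univ_sdiff]
      by_cases ht : t.card = h
      · simp [ht]
      · simp [ht, Ne.symm ht]
    simp only [this]
    rw [Finset.sum_congr rfl fun t ht => if_pos (Finset.mem_powersetCard.1 ht).2,
      Finset.sum_congr rfl fun t ht => if_neg (Finset.mem_filter.1 ht).2]
    simp
  have h1 : (pfaffian (Matrix.of fun j l => X * C (A j l) + C (B j l))).coeff h =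
      (2 ^ (h + m) * (h + m).factorial : ℂ)⁻¹ * altSum (splitEquiv h m) (fun s =>
        ∑ t ∈ Finset.univ.powersetCard h, (∏ j ∈ t, A (s (j, 0)) (s (j, 1))) *
          ∏ j ∈ tᶜ, B (s (j, 0)) (s (j, 1))) := by
    unfold pfaffian altSum
    simp only [hprod, coeff_smul, finsetSum_coeff, hN]
    simp only [hcoeff, zsmul_eq_mul]
    rw [Algebra.smul_def]
    congr 1
    simp
  have hc : (Finset.univ.map Function.Embedding.inl : Finset (Fin h ⊕ Fin m)).card = h := by simp
  have hcompl : (Finset.univ.map Function.Embedding.inl : Finset (Fin h ⊕ Fin m))ᶜ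
      = Finset.univ.map Function.Embedding.inr := by
    ext x; rcases x with x | x <;> simp
  rw [h1, altSum_sum, Finset.sum_congr rfl fun t ht => altSum_prod_subset (splitEquiv h m) A B t
    (Finset.univ.map Function.Embedding.inl) ((Finset.mem_powersetCard.1 ht).2.trans hc.symm)]
  rw [hcompl, Finset.sum_const, Finset.card_powersetCard, nsmul_eq_mul, ← mul_assoc]
  simp only [Finset.prod_map, Function.Embedding.inl_apply, Function.Embedding.inr_apply]
  congr 1
  have hch := Nat.add_choose_mul_factorial_mul_factorial h m
  have hch' : ((h + m).choose h : ℂ) * h.factorial * m.factorial = (h + m).factorial := by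
    rw [Nat.choose_symm_add]; exact_mod_cast hch
  simp only [Finset.card_univ, Fintype.card_sum, Fintype.card_fin]
  have n1 : (h.factorial : ℂ) ≠ 0 := by exact_mod_cast h.factorial_ne_zero
  have n2 : (m.factorial : ℂ) ≠ 0 := by exact_mod_cast m.factorial_ne_zero
  have n3 : ((h + m).choose h : ℂ) ≠ 0 := by
    exact_mod_cast (Nat.choose_pos (Nat.le_add_right h m)).ne'
  rw [← hch']
  field_simp

/-- This absorbs the sign of a Schur term: permuting the functions F among the α positions costs
exactly sgn π, while the β positions stay fixed. -/
theorem altSum_prod_perm {α β κ R : Type*} [Fintype α] [DecidableEq α] [Fintype β]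
    [DecidableEq β] [Fintype κ] [DecidableEq κ] [CommRing R] (E : (α ⊕ β) × Fin 2 ≃ κ)
    (F : α × Fin 2 → κ → R) (b : (β × Fin 2 → κ) → R) (π : Perm (α × Fin 2)) :
    altSum E (fun s => (∏ q, F q (s (Sum.inl q.1, q.2))) * b (fun q => s (Sum.inr q.1, q.2))) =
      ((Perm.sign π : ℤ) : R) * altSum E (fun s => (∏ q, F (π q) (s (Sum.inl q.1, q.2))) *
        b (fun q => s (Sum.inr q.1, q.2))) := by
  have h1 := altSum_comp_perm E (fun s => (∏ q, F (π q) (s (Sum.inl q.1, q.2))) *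
        b (fun q => s (Sum.inr q.1, q.2)))
    ((sumProdDistrib α β (Fin 2)).symm.permCongr (sumCongr π 1))
  rw [Perm.sign_permCongr, Perm.sign_sumCongr, Perm.sign_one, mul_one] at h1
  rw [← h1]
  congr 1
  ext s
  simp only [permCongr_apply, symm_symm, sumProdDistrib_apply_left, sumProdDistrib_apply_right,
    sumCongr_apply, Sum.map_inl, Sum.map_inr, Perm.one_apply, sumProdDistrib_symm_apply_left,
    sumProdDistrib_symm_apply_right]
  congr 1
  exact (Equiv.prod_comp π (fun q => F q (s (Sum.inl q.1, q.2)))).symm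

/-! ### The Vandermonde product of the eigenvalues -/

theorem Delta_eq_det {N : ℕ} (z : Fin N → ℂ) : Delta z = (Matrix.vandermonde z).det :=
  (Matrix.det_vandermonde z).symm

theorem Delta_succ {n : ℕ} (z : Fin (n + 1) → ℂ) :
    Delta z = Delta (fun i => z i.castSucc) * ∏ i, (z (Fin.last n) - z (Fin.castSucc i)) := by
  have ite : ∀ {n : ℕ} (z : Fin n → ℂ),
      Delta z = ∏ j, ∏ l, if j < l then z l - z j else 1 := by
    intro n z
    unfold Delta
    refine Finset.prod_congr rfl fun j _ => ?_
    rw [← Finset.prod_filter]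
    exact Finset.prod_congr (by ext; simp) fun _ _ => rfl
  rw [ite, ite, Fin.prod_univ_castSucc]
  simp only [Fin.prod_univ_castSucc (n := n), Fin.castSucc_lt_castSucc_iff, Fin.castSucc_lt_last,
    if_true, lt_irrefl, if_false, Finset.prod_mul_distrib]
  have : ∀ i : Fin n, ¬ Fin.last n < i.castSucc := fun i => not_lt.2 (Fin.le_last _)
  simp [this]

section eigenvalues

variable {k m : ℕ} (lam : Fin k → ℝ) (w : Fin m → ℝ × ℝ)

theorem eigenvalues_castAdd (j : Fin k) :
    eigenvalues lam w (Fin.castAdd (2 * m) j) = lam j := by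
  simp [eigenvalues]

theorem eigenvalues_natAdd_zero (i : Fin m) :
    eigenvalues lam w (Fin.natAdd k (pairEquiv m (i, 0))) =
      ((w i).1 : ℂ) + Complex.I * (w i).2 := by
  rw [pairEquiv_zero, eigenvalues, Fin.append_right]; simp

theorem eigenvalues_natAdd_one (i : Fin m) :
    eigenvalues lam w (Fin.natAdd k (pairEquiv m (i, 1))) =
      ((w i).1 : ℂ) - Complex.I * (w i).2 := by
  have h : (2 * (i : ℕ) + 1) / 2 = i := by omega
  rw [pairEquiv_one, eigenvalues, Fin.append_right]; simp [Nat.add_mod, h]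

theorem prod_eigenvalues (F : Fin (k + 2 * m) → ℂ → ℂ) :
    ∏ l, F l (eigenvalues lam w l) = (∏ j, F (Fin.castAdd (2 * m) j) (lam j)) *
      ∏ i, (F (Fin.natAdd k (pairEquiv m (i, 0))) (((w i).1 : ℂ) + Complex.I * (w i).2) *
        F (Fin.natAdd k (pairEquiv m (i, 1))) (((w i).1 : ℂ) - Complex.I * (w i).2)) := by
  rw [Fin.prod_univ_add, ← (pairEquiv m).prod_comp, Fintype.prod_prod_type]
  simp only [Fin.prod_univ_two, eigenvalues_castAdd, eigenvalues_natAdd_zero,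
    eigenvalues_natAdd_one]

theorem prod_conj_eigenvalues (F : ℂ → ℂ) :
    ∏ l, F (starRingEnd ℂ (eigenvalues lam w l)) = ∏ l, F (eigenvalues lam w l) := by
  rw [prod_eigenvalues lam w (fun _ z => F (starRingEnd ℂ z)),
    prod_eigenvalues lam w (fun _ z => F z)]
  congr 1
  · simp
  · refine Finset.prod_congr rfl fun i _ => ?_
    rw [mul_comm]
    simp [sub_eq_add_neg]

end eigenvalues

/-- `k + 2 * (m + 1)` unfolds to `k + 2 * m + 1 + 1`, so dropping the last two positions removes the
last conjugate pair; this feeds the induction on m. -/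
theorem eigenvalues_castSucc {k m : ℕ} (lam : Fin k → ℝ) (w : Fin (m + 1) → ℝ × ℝ)
    (i : Fin (k + 2 * m)) :
    eigenvalues lam w (Fin.castSucc (Fin.castSucc i) : Fin (k + 2 * m + 1 + 1)) =
      eigenvalues lam (fun i => w i.castSucc) i := by
  refine Fin.addCases (fun j => ?_) (fun j => ?_) i
  · rw [eigenvalues_castAdd]
    exact eigenvalues_castAdd lam w j
  · obtain ⟨⟨j, e⟩, rfl⟩ := (pairEquiv m).surjective j
    have h0 := eigenvalues_natAdd_zero lam w j.castSucc
    have h1 := eigenvalues_natAdd_one lam w j.castSucc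
    rw [pairEquiv_zero] at h0
    rw [pairEquiv_one] at h1
    fin_cases e
    · refine Eq.trans ?_ (eigenvalues_natAdd_zero lam (fun i => w i.castSucc) j).symm
      refine Eq.trans ?_ h0
      congr 1
      change Fin.castSucc (Fin.castSucc (Fin.natAdd k (pairEquiv m (j, 0)))) = _
      rw [pairEquiv_zero]; rfl
    · refine Eq.trans ?_ (eigenvalues_natAdd_one lam (fun i => w i.castSucc) j).symm
      refine Eq.trans ?_ h1
      congr 1
      change Fin.castSucc (Fin.castSucc (Fin.natAdd k (pairEquiv m (j, 1)))) = _
      rw [pairEquiv_one]; rfl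

/-- The earlier family is closed under conjugation, so the factors of the new z̄ against it are
conjugate to those of z and together give a squared modulus. The new pair contributes z̄ - z = -2iy.
-/
theorem Delta_eigenvalues_succ {k m : ℕ} (lam : Fin k → ℝ) (w : Fin (m + 1) → ℝ × ℝ) :
    Delta (eigenvalues lam w) = Delta (eigenvalues lam (fun i => w i.castSucc)) *
      (‖∏ l, (((w (Fin.last m)).1 : ℂ) + Complex.I * (w (Fin.last m)).2 -
        eigenvalues lam (fun i => w i.castSucc) l)‖ ^ 2 : ℝ) *
      (-2 * Complex.I * (w (Fin.last m)).2) := by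
  have l0 : eigenvalues lam w (Fin.castSucc (Fin.last (k + 2 * m)) : Fin (k + 2 * m + 1 + 1)) =
      ((w (Fin.last m)).1 : ℂ) + Complex.I * (w (Fin.last m)).2 := by
    refine Eq.trans ?_ (eigenvalues_natAdd_zero lam w (Fin.last m))
    congr 1
    rw [pairEquiv_zero]; rfl
  have l1 : eigenvalues lam w (Fin.last (k + 2 * m + 1)) =
      ((w (Fin.last m)).1 : ℂ) - Complex.I * (w (Fin.last m)).2 := by
    refine Eq.trans ?_ (eigenvalues_natAdd_one lam w (Fin.last m))
    congr 1
    rw [pairEquiv_one]; rfl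
  have hz : (((w (Fin.last m)).1 : ℂ) - Complex.I * (w (Fin.last m)).2) =
      starRingEnd ℂ (((w (Fin.last m)).1 : ℂ) + Complex.I * (w (Fin.last m)).2) := by
    simp [sub_eq_add_neg]
  refine (Delta_succ (n := k + 2 * m + 1) (eigenvalues lam w)).trans ?_
  rw [Delta_succ, Fin.prod_univ_castSucc]
  simp only [eigenvalues_castSucc, l0, l1]
  have hc : ∏ l, (((w (Fin.last m)).1 : ℂ) - Complex.I * (w (Fin.last m)).2 -
        eigenvalues lam (fun i => w i.castSucc) l) =
      starRingEnd ℂ (∏ l, (((w (Fin.last m)).1 : ℂ) + Complex.I * (w (Fin.last m)).2 -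
        eigenvalues lam (fun i => w i.castSucc) l)) := by
    rw [map_prod, ← prod_conj_eigenvalues, hz]
    simp only [map_sub]
  rw [hc, Complex.ofReal_pow, ← Complex.mul_conj']
  ring

/-- On the upper half plane the sign of the Vandermonde product of a conjugation invariant family
is that of its real part, up to a power of `i`. -/
theorem norm_Delta_eigenvalues {k m : ℕ} (lam : Fin k → ℝ) (w : Fin m → ℝ × ℝ)
    (hw : ∀ i, 0 < (w i).2) :
    (‖Delta (eigenvalues lam w)‖ : ℂ) =
      Complex.I ^ m * orderSign lam * Delta (eigenvalues lam w) := by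
  induction m with
  | zero =>
    have h0 : Delta (eigenvalues lam w) = ((Matrix.vandermonde lam).det : ℂ) := by
      have : eigenvalues lam w = fun j : Fin k => (lam j : ℂ) :=
        funext fun j => eigenvalues_castAdd lam w j
      rw [this, Matrix.det_vandermonde]
      simp [Delta]
    rw [h0, orderSign, pow_zero, one_mul, Complex.norm_real, ← Complex.ofReal_mul]
    congr 1
    rcases lt_trichotomy (Matrix.vandermonde lam).det 0 with h | h | h
    · rw [Real.sign_of_neg h, Real.norm_of_nonpos h.le]; ring
    · simp [h]
    · rw [Real.sign_of_pos h, Real.norm_of_nonneg h.le]; ring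
  | succ m ih =>
    have hy := hw (Fin.last m)
    rw [Delta_eigenvalues_succ, norm_mul, norm_mul, Complex.ofReal_mul, Complex.ofReal_mul,
      ih _ fun i => hw _, Complex.norm_real, Real.norm_of_nonneg (by positivity)]
    have : ‖-2 * Complex.I * ((w (Fin.last m)).2 : ℂ)‖ = 2 * (w (Fin.last m)).2 := by
      simp [abs_of_pos hy]
    rw [this, pow_succ]
    push_cast
    -- What remains is i · (-2i) = 2: each pair uses up one factor i.
    linear_combination (2 * Complex.I ^ m * orderSign lam *
      Delta (eigenvalues lam (fun i => w i.castSucc)) *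
      (‖∏ l, (((w (Fin.last m)).1 : ℂ) + Complex.I * (w (Fin.last m)).2 -
        eigenvalues lam (fun i => w i.castSucc) l)‖ ^ 2 : ℂ) * (w (Fin.last m)).2) * Complex.I_sq

/-- Monic polynomials of degrees 0, ..., N - 1 differ from the monomials by a unitriangular change
of basis, which preserves the determinant; the rest is the Leibniz formula. -/
theorem Delta_eq_sum_perm {N : ℕ} (p : Fin N → ℂ[X]) (hmonic : ∀ j, (p j).Monic)
    (hdeg : ∀ j, (p j).natDegree = (j : ℕ)) (z : Fin N → ℂ) :
    Delta z = ∑ σ : Perm (Fin N), ((Perm.sign σ : ℤ) : ℂ) * ∏ l, (p (σ l)).eval (z l) := by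
  rw [Delta_eq_det, Matrix.det_eval_matrixOfPolynomials_eq_det_vandermonde z p hdeg hmonic,
    ← Matrix.det_transpose, Matrix.det_apply']
  simp

theorem Delta_eigenvalues_eq_altSum {h m : ℕ} (p : Fin (2 * h + 2 * m) → ℂ[X])
    (hmonic : ∀ j, (p j).Monic) (hdeg : ∀ j, (p j).natDegree = (j : ℕ))
    (lam : Fin (2 * h) → ℝ) (w : Fin m → ℝ × ℝ) :
    Delta (eigenvalues lam w) = altSum (splitEquiv h m) (fun s =>
      (∏ q : Fin h × Fin 2, (p (s (Sum.inl q.1, q.2))).eval (lam (pairEquiv h q) : ℂ)) *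
      ∏ i, ((p (s (Sum.inr i, 0))).eval (((w i).1 : ℂ) + Complex.I * (w i).2) *
        (p (s (Sum.inr i, 1))).eval (((w i).1 : ℂ) - Complex.I * (w i).2))) := by
  rw [Delta_eq_sum_perm p hmonic hdeg]
  unfold altSum
  refine Finset.sum_congr rfl fun σ _ => ?_
  rw [prod_eigenvalues lam w (fun l z => (p (σ l)).eval z), ← (pairEquiv h).prod_comp]
  simp only [splitEquiv_inl, splitEquiv_inr, Prod.mk.eta]

/-! ### Expansion of the integrand into products over pairs -/

/-- The function `u(x) e^{-b x² / 2} f(x)`. -/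
def realFactor (b : ℝ) (u : ℝ → ℂ) (f : ℂ[X]) (x : ℝ) : ℂ :=
  u x * (realWeight b x : ℂ) * f.eval (x : ℂ)

/-- The integrand of `α[u]`. -/
def alphaIntegrand (b : ℝ) (u : ℝ → ℂ) (f g : ℂ[X]) (q : ℝ × ℝ) : ℂ :=
  realFactor b u f q.1 * realFactor b u g q.2 * (Real.sign (q.2 - q.1) : ℂ)

/-- The factor 2^m of the density is exactly the cost, by `altSum_prod_antisymm`, of replacing
p_a(z) p_c(z̄) by the difference that appears in `betaIntegrand`. -/
theorem two_pow_mul_Delta_mul_weights {h m : ℕ} (τ b : ℝ) (u : ℝ → ℂ) (v : ℝ × ℝ → ℂ)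
    (p : Fin (2 * h + 2 * m) → ℂ[X])
    (hmonic : ∀ j, (p j).Monic) (hdeg : ∀ j, (p j).natDegree = (j : ℕ))
    (lam : Fin (2 * h) → ℝ) (w : Fin m → ℝ × ℝ) :
    2 ^ m * Delta (eigenvalues lam w) * (∏ l, u (lam l) * (realWeight b (lam l) : ℂ)) *
      (∏ i, v (w i) * (complexWeight τ b (w i) : ℂ)) =
    altSum (splitEquiv h m) (fun s =>
      (∏ q : Fin h × Fin 2, realFactor b u (p (s (Sum.inl q.1, q.2))) (lam (pairEquiv h q))) *
      ∏ i, betaIntegrand τ b v (p (s (Sum.inr i, 0))) (p (s (Sum.inr i, 1))) (w i)) := by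
  have h1 := altSum_prod_antisymm (R := ℂ) (splitEquiv h m)
    (fun s => ∏ q : Fin h × Fin 2, (p (s q)).eval (lam (pairEquiv h q) : ℂ))
    (fun i a c => (p a).eval (((w i).1 : ℂ) + Complex.I * (w i).2) *
        (p c).eval (((w i).1 : ℂ) - Complex.I * (w i).2))
  rw [Delta_eigenvalues_eq_altSum p hmonic hdeg]
  rw [Fintype.card_fin] at h1
  simp only at h1 ⊢
  rw [← h1, mul_assoc, mul_comm, ← altSum_const_mul]
  congr 1
  ext s
  rw [← (pairEquiv h).prod_comp (fun l => u (lam l) * (realWeight b (lam l) : ℂ))]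
  simp only [realFactor, betaIntegrand, Finset.prod_mul_distrib]
  ring

/-- Schur's identity replaces the ordering sign by a sum over π. In each term `altSum_prod_perm`
supplies a second sgn π that cancels the first, and the sign factors join the matching real factors
into `alphaIntegrand`. -/
theorem orderSign_mul_altSum {h m : ℕ} (τ b : ℝ) (u : ℝ → ℂ) (v : ℝ × ℝ → ℂ)
    (p : Fin (2 * h + 2 * m) → ℂ[X]) (lam : Fin (2 * h) → ℝ) (w : Fin m → ℝ × ℝ) :
    (2 ^ h * h.factorial * orderSign lam : ℂ) * altSum (splitEquiv h m) (fun s =>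
      (∏ q : Fin h × Fin 2, realFactor b u (p (s (Sum.inl q.1, q.2))) (lam (pairEquiv h q))) *
      ∏ i, betaIntegrand τ b v (p (s (Sum.inr i, 0))) (p (s (Sum.inr i, 1))) (w i)) =
    ∑ π : Perm (Fin (2 * h)), altSum (splitEquiv h m) (fun s =>
      (∏ i, alphaIntegrand b u (p (s (Sum.inl i, 0))) (p (s (Sum.inl i, 1)))
        (lam (π (pairEquiv h (i, 0))), lam (π (pairEquiv h (i, 1))))) *
      ∏ i, betaIntegrand τ b v (p (s (Sum.inr i, 0))) (p (s (Sum.inr i, 1))) (w i)) := by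
  have h1 := congrArg (fun r : ℝ => (r : ℂ)) (sum_sign_mul_prod_sign h lam)
  push_cast at h1
  rw [← h1, Finset.sum_mul]
  refine Finset.sum_congr rfl fun π _ => ?_
  have h2 := altSum_prod_perm (R := ℂ) (splitEquiv h m)
    (fun q a => realFactor b u (p a) (lam (pairEquiv h q)))
    (fun s => ∏ i, betaIntegrand τ b v (p (s (i, 0))) (p (s (i, 1))) (w i))
    ((pairEquiv h).symm.permCongr π)
  have hs : (((Perm.sign π : ℤ) : ℂ)) * ((Perm.sign π : ℤ) : ℂ) = 1 := by
    rcases Int.units_eq_one_or (Perm.sign π) with h | h <;> simp [h]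
  rw [h2, Perm.sign_permCongr, mul_mul_mul_comm, hs, one_mul, ← altSum_const_mul]
  congr 1
  ext s
  simp only [permCongr_apply, symm_symm, apply_symm_apply, Fintype.prod_prod_type,
    Fin.prod_univ_two, alphaIntegrand, Finset.prod_mul_distrib, pairEquiv_zero, pairEquiv_one]
  ring

theorem partitionIntegrand_eq_sum {h m : ℕ} (τ b : ℝ) (u : ℝ → ℂ) (v : ℝ × ℝ → ℂ)
    (p : Fin (2 * h + 2 * m) → ℂ[X])
    (hmonic : ∀ j, (p j).Monic) (hdeg : ∀ j, (p j).natDegree = (j : ℕ))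
    (s : (Fin (2 * h) → ℝ) × (Fin m → ℝ × ℝ)) (hs : s ∈ partitionDomain (2 * h) m) :
    partitionIntegrand (2 * h) m τ b u v s =
      (normalization (2 * h + 2 * m) τ b : ℂ) * Complex.I ^ m *
        (2 ^ h * h.factorial * (2 * h).factorial * m.factorial : ℂ)⁻¹ *
      ∑ π : Perm (Fin (2 * h)), altSum (splitEquiv h m) (fun t =>
      (∏ i, alphaIntegrand b u (p (t (Sum.inl i, 0))) (p (t (Sum.inl i, 1)))
        (s.1 (π (pairEquiv h (i, 0))), s.1 (π (pairEquiv h (i, 1))))) *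
      ∏ i, betaIntegrand τ b v (p (t (Sum.inr i, 0))) (p (t (Sum.inr i, 1))) (s.2 i)) := by
  obtain ⟨lam, w⟩ := s
  rw [← orderSign_mul_altSum, ← two_pow_mul_Delta_mul_weights τ b u v p hmonic hdeg]
  simp only [partitionIntegrand, eigenvalueDensity]
  push_cast
  rw [norm_Delta_eigenvalues lam w hs]
  simp only [Finset.prod_mul_distrib]
  have n1 : (h.factorial : ℂ) ≠ 0 := by exact_mod_cast h.factorial_ne_zero
  have n2 : (m.factorial : ℂ) ≠ 0 := by exact_mod_cast m.factorial_ne_zero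
  have n3 : ((2 * h).factorial : ℂ) ≠ 0 := by exact_mod_cast (2 * h).factorial_ne_zero
  field_simp

/-! ### Fubini for products over pairs of real variables -/

section pairs

variable {α ι : Type*}

/-- The splitting of a finite family of real variables into pairs. -/
def pairsMeasurableEquiv (e : α ⊕ α ≃ ι) : (α → ℝ × ℝ) ≃ᵐ (ι → ℝ) :=
  (MeasurableEquiv.arrowProdEquivProdArrow ℝ ℝ α).trans
    ((MeasurableEquiv.sumPiEquivProdPi (fun _ : α ⊕ α => ℝ)).symm.trans
      (MeasurableEquiv.piCongrLeft (fun _ => ℝ) e))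

theorem pairsMeasurableEquiv_apply (e : α ⊕ α ≃ ι) (y : α → ℝ × ℝ) (a : α ⊕ α) :
    pairsMeasurableEquiv e y (e a) = Sum.elim (fun i => (y i).1) (fun i => (y i).2) a := by
  change (Equiv.piCongrLeft (fun _ => ℝ) e) _ (e a) = _
  rw [Equiv.piCongrLeft_apply_apply]
  rcases a with a | a <;> rfl

variable [Fintype α] [Fintype ι]

theorem volume_preserving_pairsMeasurableEquiv (e : α ⊕ α ≃ ι) :
    MeasurePreserving (pairsMeasurableEquiv e) :=
  ((volume_measurePreserving_piCongrLeft (fun _ => ℝ) e).comp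
    (volume_measurePreserving_sumPiEquivProdPi_symm (fun _ : α ⊕ α => ℝ))).comp
      (volume_measurePreserving_arrowProdEquivProdArrow ℝ ℝ α)

theorem integral_prod_pairs (e : α ⊕ α ≃ ι) (F : α → ℝ × ℝ → ℂ) :
    ∫ x : ι → ℝ, ∏ i, F i (x (e (Sum.inl i)), x (e (Sum.inr i))) = ∏ i, ∫ q, F i q := by
  rw [← (volume_preserving_pairsMeasurableEquiv e).integral_comp']
  simp only [pairsMeasurableEquiv_apply, Sum.elim_inl, Sum.elim_inr, Prod.mk.eta]
  exact integral_fintype_prod_volume_eq_prod F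

theorem integrable_prod_pairs (e : α ⊕ α ≃ ι) {F : α → ℝ × ℝ → ℂ} (hF : ∀ i, Integrable (F i)) :
    Integrable fun x : ι → ℝ => ∏ i, F i (x (e (Sum.inl i)), x (e (Sum.inr i))) := by
  rw [← (volume_preserving_pairsMeasurableEquiv e).integrable_comp_emb
    (MeasurableEquiv.measurableEmbedding _)]
  simp only [Function.comp_def, pairsMeasurableEquiv_apply, Sum.elim_inl, Sum.elim_inr,
    Prod.mk.eta]
  exact Integrable.fintype_prod hF

end pairs

/-- The two members of each pair. -/
def sumSelfEquiv (α : Type*) : α ⊕ α ≃ α × Fin 2 :=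
  ((boolProdEquivSum α).symm.trans (prodComm Bool α)).trans
    (prodCongr (Equiv.refl α) finTwoEquiv.symm)

/-- The sign kernel is measurable and bounded by 1, so the product of two integrable one-variable
factors dominates. -/
theorem integrable_alphaIntegrand {b : ℝ} {u : ℝ → ℂ} {f g : ℂ[X]}
    (hf : Integrable (realFactor b u f)) (hg : Integrable (realFactor b u g)) :
    Integrable (alphaIntegrand b u f g) := by
  have hs : Measurable fun q : ℝ × ℝ => (Real.sign (q.2 - q.1) : ℂ) := by
    unfold Real.sign
    refine Complex.measurable_ofReal.comp (Measurable.ite ?_ measurable_const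
      (Measurable.ite ?_ measurable_const measurable_const))
    · exact measurableSet_lt (by fun_prop) measurable_const
    · exact measurableSet_lt measurable_const (by fun_prop)
  refine (hf.mul_prod hg).mul_bdd (c := 1) hs.aestronglyMeasurable (.of_forall fun q => ?_)
  rcases Real.sign_apply_eq (q.2 - q.1) with h | h | h <;> simp [h]

theorem integral_alphaIntegrand {b : ℝ} {u : ℝ → ℂ} {f g : ℂ[X]}
    (hf : Integrable (realFactor b u f)) (hg : Integrable (realFactor b u g)) :
    ∫ q, alphaIntegrand b u f g q = alpha b u f g := by
  rw [Measure.volume_eq_prod, integral_prod _ (integrable_alphaIntegrand hf hg), alpha]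
  congr 1
  ext x
  rw [← integral_const_mul]
  congr 1
  ext y
  have hexp : Real.exp (-b * (x ^ 2 + y ^ 2) / 2) = realWeight b x * realWeight b y := by
    rw [realWeight, realWeight, ← Real.exp_add]
    congr 1
    ring
  rw [hexp, alphaIntegrand, realFactor, realFactor]
  push_cast
  ring

/-! ### Integration of the expansion -/

section partition

variable {h m : ℕ} {τ b : ℝ} {u : ℝ → ℂ} {v : ℝ × ℝ → ℂ} {p : Fin (2 * h + 2 * m) → ℂ[X]}

theorem volume_restrict_partitionDomain (k m : ℕ) :
    volume.restrict (partitionDomain k m) =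
      (volume : Measure (Fin k → ℝ)).prod (Measure.pi fun _ : Fin m =>
        (volume : Measure (ℝ × ℝ)).restrict upperHalf) := by
  have : partitionDomain k m = Set.univ ×ˢ Set.univ.pi fun _ => upperHalf := by
    ext s; simp [partitionDomain]
  rw [this, Measure.volume_eq_prod, ← Measure.prod_restrict, Measure.restrict_univ, volume_pi
    (α := fun _ : Fin m => ℝ × ℝ), Measure.restrict_pi_pi]

theorem measurableSet_partitionDomain (k m : ℕ) : MeasurableSet (partitionDomain k m) := by
  have : partitionDomain k m = ⋂ j, {s | 0 < (s.2 j).2} := by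
    ext s; simp [partitionDomain, upperHalf]
  rw [this]
  exact MeasurableSet.iInter fun j => measurableSet_lt measurable_const (by fun_prop)

theorem integrable_expansion_term (hu : ∀ j, Integrable (realFactor b u (p j)))
    (hv : ∀ j l, IntegrableOn (betaIntegrand τ b v (p j) (p l)) upperHalf)
    (π : Perm (Fin (2 * h))) (t : (Fin h ⊕ Fin m) × Fin 2 → Fin (2 * h + 2 * m)) :
    IntegrableOn (fun s : (Fin (2 * h) → ℝ) × (Fin m → ℝ × ℝ) =>
      (∏ i, alphaIntegrand b u (p (t (Sum.inl i, 0))) (p (t (Sum.inl i, 1)))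
        (s.1 (π (pairEquiv h (i, 0))), s.1 (π (pairEquiv h (i, 1))))) *
      ∏ i, betaIntegrand τ b v (p (t (Sum.inr i, 0))) (p (t (Sum.inr i, 1))) (s.2 i))
      (partitionDomain (2 * h) m) := by
  rw [IntegrableOn, volume_restrict_partitionDomain]
  have h1 := integrable_prod_pairs ((sumSelfEquiv (Fin h)).trans ((pairEquiv h).trans π))
    (F := fun i => alphaIntegrand b u (p (t (Sum.inl i, 0))) (p (t (Sum.inl i, 1))))
    fun i => integrable_alphaIntegrand (hu _) (hu _)
  exact h1.mul_prod (Integrable.fintype_prod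
    (f := fun i => betaIntegrand τ b v (p (t (Sum.inr i, 0))) (p (t (Sum.inr i, 1))))
    fun i => hv _ _)

/-- The α and β factors depend on disjoint groups of variables, so the integral factors. Relabelling
the real variables by π preserves Lebesgue measure, hence the value is free of π. -/
theorem integral_expansion_term (hu : ∀ j, Integrable (realFactor b u (p j)))
    (π : Perm (Fin (2 * h))) (t : (Fin h ⊕ Fin m) × Fin 2 → Fin (2 * h + 2 * m)) :
    ∫ s in partitionDomain (2 * h) m,
      (∏ i, alphaIntegrand b u (p (t (Sum.inl i, 0))) (p (t (Sum.inl i, 1)))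
        (s.1 (π (pairEquiv h (i, 0))), s.1 (π (pairEquiv h (i, 1))))) *
      ∏ i, betaIntegrand τ b v (p (t (Sum.inr i, 0))) (p (t (Sum.inr i, 1))) (s.2 i) =
    (∏ i, alpha b u (p (t (Sum.inl i, 0))) (p (t (Sum.inl i, 1)))) *
      ∏ i, ∫ q in upperHalf, betaIntegrand τ b v (p (t (Sum.inr i, 0))) (p (t (Sum.inr i, 1))) q := by
  have h1 := integral_prod_pairs ((sumSelfEquiv (Fin h)).trans ((pairEquiv h).trans π))
    (F := fun i => alphaIntegrand b u (p (t (Sum.inl i, 0))) (p (t (Sum.inl i, 1))))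
  have h2 := integral_fintype_prod_eq_prod (𝕜 := ℂ)
    (μ := fun _ : Fin m => (volume : Measure (ℝ × ℝ)).restrict upperHalf)
    (fun i => betaIntegrand τ b v (p (t (Sum.inr i, 0))) (p (t (Sum.inr i, 1))))
  simp only [integral_alphaIntegrand (hu _) (hu _)] at h1
  rw [volume_restrict_partitionDomain, ← h1, ← h2, ← integral_prod_mul]
  rfl

theorem integrableOn_altSum (hu : ∀ j, Integrable (realFactor b u (p j)))
    (hv : ∀ j l, IntegrableOn (betaIntegrand τ b v (p j) (p l)) upperHalf)
    (π : Perm (Fin (2 * h))) :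
    IntegrableOn (fun s : (Fin (2 * h) → ℝ) × (Fin m → ℝ × ℝ) =>
      altSum (splitEquiv h m) (fun t =>
      (∏ i, alphaIntegrand b u (p (t (Sum.inl i, 0))) (p (t (Sum.inl i, 1)))
        (s.1 (π (pairEquiv h (i, 0))), s.1 (π (pairEquiv h (i, 1))))) *
      ∏ i, betaIntegrand τ b v (p (t (Sum.inr i, 0))) (p (t (Sum.inr i, 1))) (s.2 i)))
      (partitionDomain (2 * h) m) := by
  unfold altSum
  exact integrable_finsetSum _ fun σ _ =>
    (integrable_expansion_term hu hv π (fun a => σ (splitEquiv h m a))).const_mul _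

theorem integral_altSum (hu : ∀ j, Integrable (realFactor b u (p j)))
    (hv : ∀ j l, IntegrableOn (betaIntegrand τ b v (p j) (p l)) upperHalf)
    (π : Perm (Fin (2 * h))) :
    ∫ s in partitionDomain (2 * h) m, altSum (splitEquiv h m) (fun t =>
      (∏ i, alphaIntegrand b u (p (t (Sum.inl i, 0))) (p (t (Sum.inl i, 1)))
        (s.1 (π (pairEquiv h (i, 0))), s.1 (π (pairEquiv h (i, 1))))) *
      ∏ i, betaIntegrand τ b v (p (t (Sum.inr i, 0))) (p (t (Sum.inr i, 1))) (s.2 i)) =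
    altSum (splitEquiv h m) (fun t =>
      (∏ i, alpha b u (p (t (Sum.inl i, 0))) (p (t (Sum.inl i, 1)))) *
      ∏ i, ∫ q in upperHalf,
        betaIntegrand τ b v (p (t (Sum.inr i, 0))) (p (t (Sum.inr i, 1))) q) := by
  unfold altSum
  rw [integral_finsetSum _ fun σ _ =>
    (integrable_expansion_term hu hv π (fun a => σ (splitEquiv h m a))).const_mul _]
  refine Finset.sum_congr rfl fun σ _ => ?_
  rw [integral_const_mul]
  congr 1
  exact integral_expansion_term hu π (fun a => σ (splitEquiv h m a))

theorem partitionFunction_eq_coeff_pfaffian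
    (hmonic : ∀ j, (p j).Monic) (hdeg : ∀ j, (p j).natDegree = (j : ℕ))
    (hu : ∀ j, Integrable (realFactor b u (p j)))
    (hv : ∀ j l, IntegrableOn (betaIntegrand τ b v (p j) (p l)) upperHalf) :
    IntegrableOn (partitionIntegrand (2 * h) m τ b u v) (partitionDomain (2 * h) m) ∧
    partitionFunction (2 * h) m τ b u v = (normalization (2 * h + 2 * m) τ b : ℂ) *
      (pfaffian (skewMatrix τ b u v p)).coeff h := by
  have hexp := fun s hs => partitionIntegrand_eq_sum (h := h) (m := m) τ b u v p hmonic hdeg s hs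
  constructor
  · refine IntegrableOn.congr_fun ?_ (fun s hs => (hexp s hs).symm)
      (measurableSet_partitionDomain _ _)
    exact (integrable_finsetSum _ fun π _ => integrableOn_altSum hu hv π).const_mul _
  · rw [partitionFunction, setIntegral_congr_fun (measurableSet_partitionDomain _ _) hexp,
      integral_const_mul, integral_finsetSum _ fun π _ => integrableOn_altSum hu hv π]
    simp only [integral_altSum hu hv]
    rw [skewMatrix, coeff_pfaffian_eq_altSum]
    simp only [beta, Finset.prod_mul_distrib, Finset.prod_const, Finset.card_univ,
      Fintype.card_fin, mul_left_comm _ (2 ^ m * Complex.I ^ m)]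
    -- The (2h)! permutations π contribute equally and cancel the 1/(2h)! of the density. The
    -- factors 2i of the m entries β give 2^m i^m, which matches the i^m from the modulus and the
    -- 2^(h+m) of the Pfaffian.
    rw [altSum_const_mul, Finset.sum_const, Finset.card_univ,
      Fintype.card_perm, Fintype.card_fin, nsmul_eq_mul]
    have n1 : (h.factorial : ℂ) ≠ 0 := by exact_mod_cast h.factorial_ne_zero
    have n2 : (m.factorial : ℂ) ≠ 0 := by exact_mod_cast m.factorial_ne_zero
    have n3 : ((2 * h).factorial : ℂ) ≠ 0 := by exact_mod_cast (2 * h).factorial_ne_zero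
    field_simp
    ring

end partition

end

end PartlySymmetricGinibre

/-- The sign has modulus 1 off the null diagonal, so the absolute integral of the α integrand is a
product of two one-variable integrals. The choice l = j shows that absolute convergence of all
α_{j,l} amounts to `hu`. -/
theorem proposition1 (N k : ℕ) (hN : Even N) (hk : Even k) (hkN : k ≤ N)
    (τ b : ℝ) (hτ0 : 0 ≤ τ) (hτ1 : τ < 1) (hb : 0 < b)
    (p : Fin N → Polynomial ℂ) (hmonic : ∀ j, (p j).Monic) (hdeg : ∀ j, (p j).natDegree = (j : ℕ))
    (u : ℝ → ℂ) (v : ℝ × ℝ → ℂ)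
    (hu : ∀ j : Fin N, MeasureTheory.Integrable (fun x : ℝ =>
      u x * (PartlySymmetricGinibre.realWeight b x : ℂ) * (p j).eval (x : ℂ)))
    (hv : ∀ j l : Fin N, MeasureTheory.IntegrableOn
      (PartlySymmetricGinibre.betaIntegrand τ b v (p j) (p l)) PartlySymmetricGinibre.upperHalf) :
    MeasureTheory.IntegrableOn
      (PartlySymmetricGinibre.partitionIntegrand k ((N - k) / 2) τ b u v)
      (PartlySymmetricGinibre.partitionDomain k ((N - k) / 2)) ∧
    PartlySymmetricGinibre.partitionFunction k ((N - k) / 2) τ b u v =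
      (PartlySymmetricGinibre.normalization N τ b : ℂ) *
        (PartlySymmetricGinibre.pfaffian
          (PartlySymmetricGinibre.skewMatrix τ b u v p)).coeff (k / 2) := by
  obtain ⟨h, rfl⟩ := hk.two_dvd
  obtain ⟨m, rfl⟩ : ∃ m, N = 2 * h + 2 * m := by
    obtain ⟨n, rfl⟩ := hN.two_dvd
    exact ⟨n - h, by omega⟩
  have hm : (2 * h + 2 * m - 2 * h) / 2 = m := by omega
  have hh : 2 * h / 2 = h := by omega
  rw [hm, hh]
  exact PartlySymmetricGinibre.partitionFunction_eq_coeff_pfaffian hmonic hdeg hu hv
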